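/- Let $R$ be a (not necessarily commutative) ring with unity. Complexes are unbounded ($\mathbb{Z}$-indexed) complexes of modules, and module means left $R$-module unless stated otherwise. For complexes $C, Y$ of $R$-modules let $\mathcal{H}om(C,Y)$ be the complex of abelian groups which in degree $n$ is $\prod_{k}\operatorname{Hom}_R(C_k,Y_{k+n})$, with $(\delta f)_k = d f_k-(-1)^n f_{k-1} d$. For a complex $Z$ of right $R$-modules let $Z\otimes_R C$ be the total tensor product, which in degree $n$ is $\bigoplus_{p+q=n} Z_p\otimes_R C_q$, with $d(z\otimes c)=dz\otimes c+(-1)^p z\otimes dc$ for $z\in Z_p$. A complex $Y$ of $R$-modules is called pure exact if $K\otimes_R Y$ is exact for every right $R$-module $K$; a complex $Z$ of right $R$-modules is called pure exact if $Z\otimes_R M$ is exact for every left $R$-module $M$. Let $C$ be a complex of projective $R$-modules. 1. If $Y$ is a pure exact complex of $R$-modules, then $\mathcal{H}om(C,Y)$ is exact, and $\operatorname{Ext}^1_{\mathrm{Ch}(R)}(C,Y)=0$, where $\operatorname{Ext}^1$ is taken in the abelian category $\mathrm{Ch}(R)$ of complexes of $R$-modules. 2. If $Z$ is a pure exact complex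 of right $R$-modules, then $Z\otimes_R C$ is exact. Moreover, every exact complex $Y$ of flat $R$-modules all of whose cycle modules are flat is pure exact; so part 1 applies to all such $Y$ (which is the case proved by Neeman). -/

import Mathlib

open CategoryTheory Limits
open scoped TensorProduct

universe u

noncomputable section

/-! Throughout, left `R`-modules are objects of `ModuleCat R`, and right `R`-modules are objects of
`ModuleCat Rᵐᵒᵖ`, the right action being `k · r = MulOpposite.op r • k`. -/

namespace BalTensor

variable (R : Type u) [Ring R]

/-- The subgroup of `K ⊗[ℤ] M` generated by the elements `(k · r) ⊗ m - k ⊗ (r • m)`. -/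
def relations (K M : Type u) [AddCommGroup K] [Module Rᵐᵒᵖ K] [AddCommGroup M] [Module R M] :
    AddSubgroup (K ⊗[ℤ] M) :=
  AddSubgroup.closure {t | ∃ (k : K) (r : R) (m : M),
    t = (MulOpposite.op r • k) ⊗ₜ[ℤ] m - k ⊗ₜ[ℤ] (r • m)}

/-- The abelian group `K ⊗_R M`, for a right module `K` and a left module `M` over a ring `R`
that need not be commutative. -/
abbrev Carrier (K M : Type u) [AddCommGroup K] [Module Rᵐᵒᵖ K] [AddCommGroup M] [Module R M] :
    Type u :=
  (K ⊗[ℤ] M) ⧸ relations R K M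

/-- The elementary tensor `k ⊗ m` in `K ⊗_R M`. -/
def tmul {K M : Type u} [AddCommGroup K] [Module Rᵐᵒᵖ K] [AddCommGroup M] [Module R M]
    (k : K) (m : M) : Carrier R K M :=
  QuotientAddGroup.mk' (relations R K M) (k ⊗ₜ[ℤ] m)

variable {R}
variable {K L N : Type u} [AddCommGroup K] [Module Rᵐᵒᵖ K] [AddCommGroup L] [Module Rᵐᵒᵖ L]
  [AddCommGroup N] [Module Rᵐᵒᵖ N]
variable {M P Q : Type u} [AddCommGroup M] [Module R M] [AddCommGroup P] [Module R P]
  [AddCommGroup Q] [Module R Q]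

/-- The map `f ⊗ g : K ⊗_R M → L ⊗_R P`. -/
def map (f : K →ₗ[Rᵐᵒᵖ] L) (g : M →ₗ[R] P) : Carrier R K M →+ Carrier R L P :=
  QuotientAddGroup.map _ _
    (TensorProduct.map f.toAddMonoidHom.toIntLinearMap
      g.toAddMonoidHom.toIntLinearMap).toAddMonoidHom (by
      rw [relations, AddSubgroup.closure_le]
      rintro _ ⟨k, r, m, rfl⟩
      exact AddSubgroup.subset_closure ⟨f k, r, g m, by simp⟩)

@[simp]
lemma map_tmul (f : K →ₗ[Rᵐᵒᵖ] L) (g : M →ₗ[R] P) (k : K) (m : M) :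
    map f g (tmul R k m) = tmul R (f k) (g m) := rfl

lemma tmul_add (k : K) (m m' : M) : tmul R k (m + m') = tmul R k m + tmul R k m' := by
  simp [tmul, TensorProduct.tmul_add]

lemma add_tmul (k k' : K) (m : M) : tmul R (k + k') m = tmul R k m + tmul R k' m := by
  simp [tmul, TensorProduct.add_tmul]

lemma smul_tmul (k : K) (r : R) (m : M) :
    tmul R (MulOpposite.op r • k) m = tmul R k (r • m) := by
  rw [← sub_eq_zero, tmul, tmul, ← map_sub]
  exact (QuotientAddGroup.eq_zero_iff _).2 (AddSubgroup.subset_closure ⟨k, r, m, rfl⟩)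

lemma hom_ext {A : Type u} [AddCommGroup A] {φ ψ : Carrier R K M →+ A}
    (h : ∀ k m, φ (tmul R k m) = ψ (tmul R k m)) : φ = ψ := by
  refine QuotientAddGroup.addMonoidHom_ext _ (AddMonoidHom.ext fun t => ?_)
  induction t with
  | zero => simp
  | tmul k m => exact h k m
  | add x y hx hy => rw [AddMonoidHom.map_add, AddMonoidHom.map_add, hx, hy]

lemma map_id :
    map (LinearMap.id : K →ₗ[Rᵐᵒᵖ] K) (LinearMap.id : M →ₗ[R] M) = AddMonoidHom.id _ :=
  hom_ext fun k m => by simp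

lemma map_comp (f : K →ₗ[Rᵐᵒᵖ] L) (f' : L →ₗ[Rᵐᵒᵖ] N) (g : M →ₗ[R] P) (g' : P →ₗ[R] Q) :
    map (f' ∘ₗ f) (g' ∘ₗ g) = (map f' g').comp (map f g) :=
  hom_ext fun k m => by simp

lemma map_add_left (f f' : K →ₗ[Rᵐᵒᵖ] L) (g : M →ₗ[R] P) : map (f + f') g = map f g + map f' g :=
  hom_ext fun k m => by simp [add_tmul]

lemma map_add_right (f : K →ₗ[Rᵐᵒᵖ] L) (g g' : M →ₗ[R] P) : map f (g + g') = map f g + map f g' :=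
  hom_ext fun k m => by simp [tmul_add]

end BalTensor

/-- The tensor product over `R` as a bifunctor `(K, M) ↦ K ⊗_R M` to abelian groups. -/
def tensorFunctor (R : Type u) [Ring R] :
    ModuleCat.{u} Rᵐᵒᵖ ⥤ ModuleCat.{u} R ⥤ AddCommGrpCat.{u} where
  obj K :=
    { obj := fun M => AddCommGrpCat.of (BalTensor.Carrier R K M)
      map := fun g => AddCommGrpCat.ofHom (BalTensor.map LinearMap.id g.hom)
      map_id := fun M => AddCommGrpCat.hom_ext BalTensor.map_id
      map_comp := fun g g' => AddCommGrpCat.hom_ext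
        (BalTensor.map_comp LinearMap.id LinearMap.id g.hom g'.hom) }
  map f :=
    { app := fun M => AddCommGrpCat.ofHom (BalTensor.map f.hom LinearMap.id)
      naturality := fun M P g => AddCommGrpCat.hom_ext
        ((BalTensor.map_comp LinearMap.id f.hom g.hom LinearMap.id).symm.trans
          (BalTensor.map_comp f.hom LinearMap.id LinearMap.id g.hom)) }
  map_id K := by
    ext M : 2
    exact AddCommGrpCat.hom_ext BalTensor.map_id
  map_comp f f' := by
    ext M : 2
    exact AddCommGrpCat.hom_ext
      (BalTensor.map_comp f.hom f'.hom LinearMap.id LinearMap.id)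

instance (R : Type u) [Ring R] : (tensorFunctor R).Additive where
  map_add {_ _ f g} := by
    ext M : 2
    exact AddCommGrpCat.hom_ext (BalTensor.map_add_left f.hom g.hom LinearMap.id)

instance (R : Type u) [Ring R] (K : ModuleCat.{u} Rᵐᵒᵖ) : ((tensorFunctor R).obj K).Additive where
  map_add {_ _ f g} :=
    AddCommGrpCat.hom_ext (BalTensor.map_add_right LinearMap.id f.hom g.hom)

instance (R : Type u) [Ring R] (M : ModuleCat.{u} R) :
    ((tensorFunctor R).flip.obj M).Additive where
  map_add {_ _ f g} :=
    AddCommGrpCat.hom_ext (BalTensor.map_add_left f.hom g.hom LinearMap.id)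

/-- The complex `K ⊗_R Y` of abelian groups, for a right module `K` and a complex `Y` of left
modules. -/
def moduleTensorComplex {R : Type u} [Ring R] (K : ModuleCat.{u} Rᵐᵒᵖ)
    (Y : CochainComplex (ModuleCat.{u} R) ℤ) : CochainComplex AddCommGrpCat.{u} ℤ :=
  (((tensorFunctor R).obj K).mapHomologicalComplex (ComplexShape.up ℤ)).obj Y

/-- The complex `Z ⊗_R M` of abelian groups, for a complex `Z` of right modules and a left
module `M`. -/
def complexTensorModule {R : Type u} [Ring R] (Z : CochainComplex (ModuleCat.{u} Rᵐᵒᵖ) ℤ)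
    (M : ModuleCat.{u} R) : CochainComplex AddCommGrpCat.{u} ℤ :=
  (((tensorFunctor R).flip.obj M).mapHomologicalComplex (ComplexShape.up ℤ)).obj Z

/-- The total tensor product `Z ⊗_R C` of a complex of right modules and a complex of left modules:
in degree `n` it is the direct sum of the `Zᵖ ⊗_R C^q` with `p + q = n`, with the differential
`d (z ⊗ c) = d z ⊗ c + (-1)ᵖ z ⊗ d c`. -/
def tensorComplex {R : Type u} [Ring R] (Z : CochainComplex (ModuleCat.{u} Rᵐᵒᵖ) ℤ)
    (C : CochainComplex (ModuleCat.{u} R) ℤ) : CochainComplex AddCommGrpCat.{u} ℤ :=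
  HomologicalComplex.mapBifunctor Z C (tensorFunctor R) (ComplexShape.up ℤ)

/-- A complex `Y` of left `R`-modules is pure exact if `K ⊗_R Y` is exact for every right
`R`-module `K`. -/
def PureExact {R : Type u} [Ring R] (Y : CochainComplex (ModuleCat.{u} R) ℤ) : Prop :=
  ∀ K : ModuleCat.{u} Rᵐᵒᵖ, (moduleTensorComplex K Y).Acyclic

/-- A complex `Z` of right `R`-modules is pure exact if `Z ⊗_R M` is exact for every left
`R`-module `M`. -/
def PureExactRight {R : Type u} [Ring R] (Z : CochainComplex (ModuleCat.{u} Rᵐᵒᵖ) ℤ) : Prop :=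
  ∀ M : ModuleCat.{u} R, (complexTensorModule Z M).Acyclic

/-- A left `R`-module `M` is flat if `- ⊗_R M` preserves injective maps of right modules. -/
def IsFlatModule {R : Type u} [Ring R] (M : ModuleCat.{u} R) : Prop :=
  ∀ ⦃K L : ModuleCat.{u} Rᵐᵒᵖ⦄ (f : K ⟶ L), Function.Injective f →
    Function.Injective (((tensorFunctor R).map f).app M)

end

/-!
The heart of the matter is that a chain map `f : C ⟶ Y` from a complex of projective modules to a
pure exact complex is null-homotopic (`PureExact.nonempty_homotopy_zero`).

A complex of projectives is a retract, as a complex, of a complex of free modules, so `C` may be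
taken free, with a basis in each degree. A null-homotopy is then built by Zorn's lemma on
subcomplexes spanned by subsets of the bases. Enlarging such a subcomplex so that it contains one
more basis element `b` adds only `b`, the basis elements in the support of `d b`, those in the
supports of their differentials, and so on: finitely many in each degree and none below the degree
of `b`. So the quotient of the enlarged subcomplex by the old one is a bounded below complex `S`
of finitely generated free modules (`PartialHomotopy.exists_extends`). For such a complex the
homotopy is built degree by degree (`PureExact.exists_homotopy_of_finite`), and what makes each
step possible is that for a map `g : S → T` of finitely generated free modules the complex
`Coker(Hom(T, Y) → Hom(S, Y))` is exact, being `K ⊗ Y` for the cokernel `K` of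
`Hom(T, R) → Hom(S, R)` (`PureExact.exists_eq_comp_add_comp`).

Since shifts of `Y` are pure exact as well, this gives the exactness of `Hom(C, Y)`. For `Ext¹`,
embed `Y` in an injective complex `I`: a morphism `C ⟶ I/Y` lifts to `I` degreewise, and the
obstruction to lifting it as a chain map is a cocycle of degree `1` in `Hom(C, Y)`, hence a
coboundary.

For a pure exact complex `Z` of right modules, `Z ⊗ C` is exact for every complex `C`. A cycle has
finitely many components `x_q` in `Z ⊗ C^q`, and its lowest component is a cycle of the exact
complex `Z ⊗ C^q`, so it can be removed. When only one component is left, it is a cycle of the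
kernel of `Z ⊗ C^q → Z ⊗ C^(q+1)`; this kernel is exact, because the two complexes and the
cokernel are (`PureExactRight.exists_of_map_eq_zero`).

Finally, if `Y` is exact with flat cycles, the short exact sequences of cycles stay exact under
`K ⊗ -`, by the vanishing of `Tor₁` (`IsFlatModule.map_id_injective`).
-/

/-! ### The balanced tensor product -/

namespace BalTensor

variable {R : Type u} [Ring R]
variable {K L N : Type u} [AddCommGroup K] [Module Rᵐᵒᵖ K] [AddCommGroup L] [Module Rᵐᵒᵖ L]
  [AddCommGroup N] [Module Rᵐᵒᵖ N]
variable {M P Q : Type u} [AddCommGroup M] [Module R M] [AddCommGroup P] [Module R P]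
  [AddCommGroup Q] [Module R Q]

@[elab_as_elim]
lemma induction {p : Carrier R K M → Prop} (zero : p 0)
    (tmul : ∀ k m, p (tmul R k m)) (add : ∀ x y, p x → p y → p (x + y)) (x : Carrier R K M) :
    p x := by
  obtain ⟨t, rfl⟩ := QuotientAddGroup.mk'_surjective _ x
  induction t with
  | zero => simpa using zero
  | tmul k m => exact tmul k m
  | add a b ha hb => simpa using add _ _ ha hb

/-- The universal property of `K ⊗_R M`: a biadditive balanced map factors through it. -/
def lift {A : Type*} [AddCommGroup A] (φ : K →+ M →+ A)
    (h : ∀ (k : K) (r : R) (m : M), φ (MulOpposite.op r • k) m = φ k (r • m)) :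
    Carrier R K M →+ A :=
  QuotientAddGroup.lift _ (TensorProduct.liftAddHom φ fun n k m => by simp) (by
    rw [relations, AddSubgroup.closure_le]
    rintro _ ⟨k, r, m, rfl⟩
    simp [h])

@[simp]
lemma lift_tmul {A : Type*} [AddCommGroup A] (φ : K →+ M →+ A)
    (h : ∀ (k : K) (r : R) (m : M), φ (MulOpposite.op r • k) m = φ k (r • m)) (k : K) (m : M) :
    lift φ h (tmul R k m) = φ k m := rfl

@[simp]
lemma tmul_zero (k : K) : tmul R k (0 : M) = 0 := by
  simp [tmul]

@[simp]
lemma zero_tmul (m : M) : tmul R (0 : K) m = 0 := by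
  simp [tmul]

lemma tmul_sub (k : K) (m m' : M) : tmul R k (m - m') = tmul R k m - tmul R k m' := by
  simp [tmul, TensorProduct.tmul_sub]

lemma sub_tmul (k k' : K) (m : M) : tmul R (k - k') m = tmul R k m - tmul R k' m := by
  simp [tmul, TensorProduct.sub_tmul]

lemma tmul_sum {ι : Type*} (s : Finset ι) (k : K) (m : ι → M) :
    tmul R k (∑ i ∈ s, m i) = ∑ i ∈ s, tmul R k (m i) :=
  map_sum (AddMonoidHom.mk' (tmul R k) (tmul_add k)) m s

lemma sum_tmul {ι : Type*} (s : Finset ι) (k : ι → K) (m : M) :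
    tmul R (∑ i ∈ s, k i) m = ∑ i ∈ s, tmul R (k i) m :=
  map_sum (AddMonoidHom.mk' (fun k : K => tmul R k m) fun _ _ => add_tmul _ _ m) k s

lemma map_map (f : K →ₗ[Rᵐᵒᵖ] L) (f' : L →ₗ[Rᵐᵒᵖ] N) (g : M →ₗ[R] P) (g' : P →ₗ[R] Q)
    (x : Carrier R K M) : map f' g' (map f g x) = map (f' ∘ₗ f) (g' ∘ₗ g) x :=
  (DFunLike.congr_fun (map_comp f f' g g') x).symm

lemma map_surjective (f : K →ₗ[Rᵐᵒᵖ] L) (g : M →ₗ[R] P) (hf : Function.Surjective f)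
    (hg : Function.Surjective g) : Function.Surjective (map f g) := by
  intro x
  induction x using induction with
  | zero => exact ⟨0, map_zero _⟩
  | tmul k m =>
    obtain ⟨k, rfl⟩ := hf k
    obtain ⟨m, rfl⟩ := hg m
    exact ⟨tmul R k m, rfl⟩
  | add x y hx hy =>
    obtain ⟨a, rfl⟩ := hx
    obtain ⟨b, rfl⟩ := hy
    exact ⟨a + b, map_add _ _ _⟩

/-- `K ⊗_R -` is right exact. -/
lemma exact_map_left (g : M →ₗ[R] P) (h : P →ₗ[R] Q) (hgh : Function.Exact g h)
    (hh : Function.Surjective h) :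
    Function.Exact (map (LinearMap.id : K →ₗ[Rᵐᵒᵖ] K) g)
      (map (LinearMap.id : K →ₗ[Rᵐᵒᵖ] K) h) := by
  have key : ∀ (k : K) (p : P), h p = 0 →
      QuotientAddGroup.mk' (map (LinearMap.id : K →ₗ[Rᵐᵒᵖ] K) g).range (tmul R k p) = 0 := by
    intro k p hp
    obtain ⟨m, rfl⟩ := (hgh p).1 hp
    exact (QuotientAddGroup.eq_zero_iff _).2 ⟨tmul R k m, rfl⟩
  -- The inverse of `(K ⊗ P) / (K ⊗ M) → K ⊗ Q` sends `k ⊗ q` to the class of `k ⊗ p` for any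
  -- lift `p` of `q`.
  choose σ hσ using hh
  have key' : ∀ (k : K) (p p' : P), h p = h p' →
      QuotientAddGroup.mk' (map (LinearMap.id : K →ₗ[Rᵐᵒᵖ] K) g).range (tmul R k p) =
      QuotientAddGroup.mk' (map (LinearMap.id : K →ₗ[Rᵐᵒᵖ] K) g).range (tmul R k p') := by
    intro k p p' hp
    rw [← sub_eq_zero, ← map_sub, ← tmul_sub]
    exact key k _ (by simp [hp])
  let ψ := lift (R := R) (AddMonoidHom.mk' (fun k : K => AddMonoidHom.mk' (fun q : Q =>
      QuotientAddGroup.mk' (map (LinearMap.id : K →ₗ[Rᵐᵒᵖ] K) g).range (tmul R k (σ q)))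
      (fun q q' => by
        rw [← map_add, ← tmul_add]
        exact key' _ _ _ (by simp [hσ])))
      (fun k k' => by
        ext q
        simp [add_tmul])) (fun k r q => by
        simp only [AddMonoidHom.mk'_apply]
        rw [smul_tmul]
        exact key' _ _ _ (by simp [hσ]))
  have hψ : ∀ x, ψ (map LinearMap.id h x) = QuotientAddGroup.mk' _ x := by
    intro x
    induction x using induction with
    | zero => simp
    | tmul k p => exact key' _ _ _ (by simp [hσ])
    | add x y hx hy => rw [map_add, map_add, hx, hy, map_add]
  intro x
  refine ⟨fun hx => ?_, ?_⟩
  · have := hψ x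
    rw [hx, map_zero] at this
    exact (QuotientAddGroup.eq_zero_iff _).1 this.symm
  · rintro ⟨y, rfl⟩
    rw [map_map, hgh.linearMap_comp_eq_zero]
    induction y using induction with
    | zero => simp
    | tmul k p => simp
    | add x y hx hy => rw [map_add, hx, hy, add_zero]

/-- `- ⊗_R M` is right exact. -/
lemma exact_map_right (g : K →ₗ[Rᵐᵒᵖ] L) (h : L →ₗ[Rᵐᵒᵖ] N) (hgh : Function.Exact g h)
    (hh : Function.Surjective h) :
    Function.Exact (map g (LinearMap.id : M →ₗ[R] M))
      (map h (LinearMap.id : M →ₗ[R] M)) := by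
  choose σ hσ using hh
  have key' : ∀ (p p' : L) (m : M), h p = h p' →
      QuotientAddGroup.mk' (map g (LinearMap.id : M →ₗ[R] M)).range (tmul R p m) =
      QuotientAddGroup.mk' (map g (LinearMap.id : M →ₗ[R] M)).range (tmul R p' m) := by
    intro p p' m hp
    rw [← sub_eq_zero, ← map_sub, ← sub_tmul]
    obtain ⟨k, hk⟩ := (hgh (p - p')).1 (by simp [hp])
    rw [← hk]
    exact (QuotientAddGroup.eq_zero_iff _).2 ⟨tmul R k m, rfl⟩
  let ψ := lift (R := R) (AddMonoidHom.mk' (fun n : N => AddMonoidHom.mk' (fun m : M =>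
      QuotientAddGroup.mk' (map g (LinearMap.id : M →ₗ[R] M)).range (tmul R (σ n) m))
      (fun m m' => by rw [← map_add, ← tmul_add]))
      (fun k k' => by
        ext m
        simp only [AddMonoidHom.mk'_apply, AddMonoidHom.add_apply]
        rw [← map_add, ← add_tmul]
        exact key' _ _ _ (by simp [hσ]))) (fun k r q => by
        simp only [AddMonoidHom.mk'_apply]
        rw [← smul_tmul]
        exact key' _ _ _ (by simp [hσ]))
  have hψ : ∀ x, ψ (map h LinearMap.id x) = QuotientAddGroup.mk' _ x := by
    intro x
    induction x using induction with
    | zero => simp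
    | tmul k p => exact key' _ _ _ (by simp [hσ])
    | add x y hx hy => rw [map_add, map_add, hx, hy, map_add]
  intro x
  refine ⟨fun hx => ?_, ?_⟩
  · have := hψ x
    rw [hx, map_zero] at this
    exact (QuotientAddGroup.eq_zero_iff _).1 this.symm
  · rintro ⟨y, rfl⟩
    rw [map_map, hgh.linearMap_comp_eq_zero]
    induction y using induction with
    | zero => simp
    | tmul k p => simp
    | add x y hx hy => rw [map_add, hx, hy, add_zero]

/-- The map `R^(ι) ⊗_R M → M^(ι)`, for the free right module `R^(ι)`. -/
noncomputable def finsuppToFinsupp (ι M : Type u) [AddCommGroup M] [Module R M] :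
    Carrier R (ι →₀ Rᵐᵒᵖ) M →+ (ι →₀ M) :=
  lift (AddMonoidHom.mk' (fun φ => AddMonoidHom.mk'
      (fun m => φ.mapRange (fun r => r.unop • m) (by simp))
      (fun m m' => by ext; simp))
      (fun φ φ' => by ext; simp [add_smul]))
    (fun φ r m => by ext; simp [mul_smul])

lemma finsuppToFinsupp_injective (ι M : Type u) [AddCommGroup M] [Module R M] :
    Function.Injective (finsuppToFinsupp (R := R) ι M) := by
  let θ : (ι →₀ M) →+ Carrier R (ι →₀ Rᵐᵒᵖ) M :=
    Finsupp.liftAddHom fun i => AddMonoidHom.mk' (tmul R (Finsupp.single i 1)) (tmul_add _)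
  refine Function.LeftInverse.injective (g := θ) fun x => ?_
  induction x using induction with
  | zero => simp
  | tmul φ m =>
    induction φ using Finsupp.induction_linear with
    | zero => simp
    | add φ φ' h h' => rw [add_tmul, map_add, map_add, h, h']
    | single i r =>
      have h1 : finsuppToFinsupp ι M (tmul R (Finsupp.single i r) m) =
          Finsupp.single i (r.unop • m) :=
        Finsupp.mapRange_single (hf := by simp)
      have h2 : Finsupp.single i r =
          (MulOpposite.op r.unop • Finsupp.single i 1 : ι →₀ Rᵐᵒᵖ) := by simp
      rw [h1, h2, smul_tmul]
      simp [θ]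
  | add x y hx hy => rw [map_add, map_add, hx, hy]

/-- Free right modules are flat. -/
lemma map_id_injective_of_finsupp (ι : Type u) (g : M →ₗ[R] P) (hg : Function.Injective g) :
    Function.Injective (map (LinearMap.id : (ι →₀ Rᵐᵒᵖ) →ₗ[Rᵐᵒᵖ] _) g) := by
  have h : ∀ x, finsuppToFinsupp ι P (map LinearMap.id g x) =
      Finsupp.mapRange.addMonoidHom g.toAddMonoidHom (finsuppToFinsupp ι M x) := by
    intro x
    induction x using induction with
    | zero => simp
    | tmul φ m =>
      rw [map_tmul]
      ext i
      simp [finsuppToFinsupp]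
    | add x y hx hy => simp only [map_add, hx, hy]
  refine Function.Injective.of_comp (f := finsuppToFinsupp ι P) ?_
  rw [show finsuppToFinsupp ι P ∘ map LinearMap.id g = _ from funext h]
  exact (Finsupp.mapRange_injective g (map_zero g) hg).comp (finsuppToFinsupp_injective ι M)

end BalTensor

/-! ### Exactness and pure exactness in terms of elements -/

lemma acyclic_iff_forall_exists (K : CochainComplex AddCommGrpCat.{u} ℤ) :
    K.Acyclic ↔ ∀ i j k : ℤ, i + 1 = j → j + 1 = k → ∀ x : K.X j, K.d j k x = 0 →
      ∃ y : K.X i, K.d i j y = x := by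
  refine ⟨fun h i j k hij hjk => ?_, fun h j => ?_⟩
  · have := h j
    rw [K.exactAt_iff' i j k (by simp [← hij]) (by simp [hjk]), ShortComplex.ab_exact_iff] at this
    exact this
  · rw [K.exactAt_iff' (j - 1) j (j + 1) (by simp) (by simp), ShortComplex.ab_exact_iff]
    exact h _ _ _ (by simp) rfl

variable {R : Type u} [Ring R]

lemma pureExact_iff (Y : CochainComplex (ModuleCat.{u} R) ℤ) :
    PureExact Y ↔ ∀ (K : ModuleCat.{u} Rᵐᵒᵖ) (i j k : ℤ), i + 1 = j → j + 1 = k →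
      ∀ x : BalTensor.Carrier R K (Y.X j),
        BalTensor.map (LinearMap.id : K →ₗ[Rᵐᵒᵖ] K) (Y.d j k).hom x = 0 →
        ∃ y, BalTensor.map (LinearMap.id : K →ₗ[Rᵐᵒᵖ] K) (Y.d i j).hom y = x :=
  forall_congr' fun _ => acyclic_iff_forall_exists _

lemma pureExactRight_iff (Z : CochainComplex (ModuleCat.{u} Rᵐᵒᵖ) ℤ) :
    PureExactRight Z ↔ ∀ (M : ModuleCat.{u} R) (i j k : ℤ), i + 1 = j → j + 1 = k →
      ∀ x : BalTensor.Carrier R (Z.X j) M,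
        BalTensor.map (Z.d j k).hom (LinearMap.id : M →ₗ[R] M) x = 0 →
        ∃ y, BalTensor.map (Z.d i j).hom (LinearMap.id : M →ₗ[R] M) y = x :=
  forall_congr' fun _ => acyclic_iff_forall_exists _

lemma CochainComplex.function_exact_of_acyclic {Y : CochainComplex (ModuleCat.{u} R) ℤ}
    (h : Y.Acyclic) {i j k : ℤ} (hij : i + 1 = j) (hjk : j + 1 = k) :
    Function.Exact (Y.d i j).hom (Y.d j k).hom := by
  have := h j
  rw [Y.exactAt_iff' i j k (by simp [← hij]) (by simp [hjk])] at this
  exact (ShortComplex.ShortExact.moduleCat_exact_iff_function_exact _).1 this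

/-! ### Flat modules -/

lemma IsFlatModule.map_injective {M : ModuleCat.{u} R} (hM : IsFlatModule M)
    {K L : Type u} [AddCommGroup K] [Module Rᵐᵒᵖ K] [AddCommGroup L] [Module Rᵐᵒᵖ L]
    (f : K →ₗ[Rᵐᵒᵖ] L) (hf : Function.Injective f) :
    Function.Injective (BalTensor.map f (LinearMap.id : M →ₗ[R] M)) :=
  hM (ModuleCat.ofHom f : ModuleCat.of _ K ⟶ ModuleCat.of _ L) hf

/-- Let `L → F → K → 0` and `M → P → Q → 0` be exact. If `F ⊗ M → F ⊗ P` and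
`L ⊗ Q → F ⊗ Q` are injective, then so is `K ⊗ M → K ⊗ P`. -/
lemma BalTensor.map_id_injective_of_presentation
    {L F K : Type u} [AddCommGroup K] [Module Rᵐᵒᵖ K] [AddCommGroup L] [Module Rᵐᵒᵖ L]
    [AddCommGroup F] [Module Rᵐᵒᵖ F] {M P Q : Type u} [AddCommGroup M] [Module R M]
    [AddCommGroup P] [Module R P] [AddCommGroup Q] [Module R Q]
    (l : L →ₗ[Rᵐᵒᵖ] F) (p : F →ₗ[Rᵐᵒᵖ] K) (hlp : Function.Exact l p) (hp : Function.Surjective p)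
    (g : M →ₗ[R] P) (h : P →ₗ[R] Q) (hgh : Function.Exact g h) (hh : Function.Surjective h)
    (hF : Function.Injective (BalTensor.map (LinearMap.id : F →ₗ[Rᵐᵒᵖ] F) g))
    (hQ : Function.Injective (BalTensor.map l (LinearMap.id : Q →ₗ[R] Q))) :
    Function.Injective (BalTensor.map (LinearMap.id : K →ₗ[Rᵐᵒᵖ] K) g) := by
  rw [injective_iff_map_eq_zero]
  intro x hx
  obtain ⟨x, rfl⟩ := BalTensor.map_surjective p (LinearMap.id : M →ₗ[R] M) hp
    Function.surjective_id x
  -- Lift the vanishing of `x` in `K ⊗ P` to an element `v` of `L ⊗ P`, which dies in `L ⊗ Q`.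
  rw [BalTensor.map_map] at hx
  obtain ⟨v, hv⟩ := (BalTensor.exact_map_right (M := P) l p hlp hp
    (BalTensor.map LinearMap.id g x)).1 (by rw [BalTensor.map_map]; exact hx)
  have hv0 : BalTensor.map LinearMap.id h v = 0 := by
    apply hQ
    have := congrArg (BalTensor.map LinearMap.id h) hv
    rw [BalTensor.map_map, BalTensor.map_map, hgh.linearMap_comp_eq_zero] at this
    rw [map_zero, BalTensor.map_map]
    refine this.trans ?_
    clear * -
    induction x using BalTensor.induction with
    | zero => simp
    | tmul k m => simp
    | add x y hx hy => rw [map_add, hx, hy, add_zero]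
  obtain ⟨w, rfl⟩ := (BalTensor.exact_map_left g h hgh hh v).1 hv0
  rw [BalTensor.map_map] at hv
  have hw : BalTensor.map l LinearMap.id w = x := by
    apply hF
    rw [BalTensor.map_map]
    exact hv
  rw [← hw]
  exact (BalTensor.exact_map_right (M := M) l p hlp hp _).2 ⟨w, rfl⟩

/-- A short exact sequence `0 → M → P → Q → 0` with `Q` flat remains exact on the left after
tensoring with any `K`: this is the vanishing of `Tor₁(K, Q)`, obtained from a presentation of `K`
by a free module. -/
lemma IsFlatModule.map_id_injective {M P : Type u} [AddCommGroup M] [Module R M] [AddCommGroup P]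
    [Module R P] {Q : ModuleCat.{u} R} (hQ : IsFlatModule Q)
    (g : M →ₗ[R] P) (h : P →ₗ[R] Q) (hg : Function.Injective g) (hgh : Function.Exact g h)
    (hh : Function.Surjective h) (K : Type u) [AddCommGroup K] [Module Rᵐᵒᵖ K] :
    Function.Injective (BalTensor.map (LinearMap.id : K →ₗ[Rᵐᵒᵖ] K) g) := by
  let p : (K →₀ Rᵐᵒᵖ) →ₗ[Rᵐᵒᵖ] K := Finsupp.linearCombination Rᵐᵒᵖ id
  obtain ⟨L, _, _, l, hl, hlp⟩ : ∃ (L : Type u) (_ : AddCommGroup L) (_ : Module Rᵐᵒᵖ L)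
      (l : L →ₗ[Rᵐᵒᵖ] K →₀ Rᵐᵒᵖ), Function.Injective l ∧ Function.Exact l p :=
    ⟨LinearMap.ker p, inferInstance, inferInstance, (LinearMap.ker p).subtype,
      Submodule.subtype_injective _, p.exact_subtype_ker_map⟩
  exact BalTensor.map_id_injective_of_presentation l p hlp
    (Finsupp.linearCombination_id_surjective Rᵐᵒᵖ K) g h hgh hh
    (BalTensor.map_id_injective_of_finsupp K g hg) (hQ.map_injective l hl)

theorem pureExact_of_isFlatModule_cycles (Y : CochainComplex (ModuleCat.{u} R) ℤ)
    (hY : Y.Acyclic) (hZ : ∀ n : ℤ, IsFlatModule (Y.cycles n)) : PureExact Y := by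
  rw [pureExact_iff]
  intro K i j k hij hjk x hx
  have hcycles : ∀ i j k : ℤ, i + 1 = j → j + 1 = k →
      Function.Injective (Y.iCycles j).hom ∧
      Function.Exact (Y.iCycles j).hom (Y.toCycles j k).hom ∧
      Function.Exact (Y.d i j).hom (Y.toCycles j k).hom ∧
      Function.Surjective (Y.toCycles j k).hom := by
    rintro i j k hij hjk
    have hinj : ∀ n, Function.Injective (Y.iCycles n).hom := fun n =>
      (ModuleCat.mono_iff_injective _).1 inferInstance
    have hd : ∀ x, (Y.iCycles k).hom ((Y.toCycles j k).hom x) = (Y.d j k).hom x := fun x => by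
      have := Y.toCycles_i j k
      exact congrArg (fun f => f.hom x) this
    have hcomp : ∀ x, (Y.d j k).hom ((Y.iCycles j).hom x) = 0 := fun x =>
      congrArg (fun f => f.hom x) (Y.iCycles_d j k)
    have hex : Function.Exact (Y.d i j).hom (Y.toCycles j k).hom := fun x => by
      rw [← (CochainComplex.function_exact_of_acyclic hY hij hjk) x, ← hd,
        map_eq_zero_iff _ (hinj k)]
    refine ⟨hinj j, fun x => ?_, hex, ?_⟩
    · constructor
      · intro hx
        obtain ⟨y, rfl⟩ := (hex x).1 hx
        exact ⟨(Y.toCycles i j).hom y, congrArg (fun f => f.hom y) (Y.toCycles_i i j)⟩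
      · rintro ⟨y, rfl⟩
        apply hinj k
        rw [hd, hcomp, map_zero]
    · intro z
      obtain ⟨y, hy⟩ := ((CochainComplex.function_exact_of_acyclic hY hjk rfl)
        ((Y.iCycles k).hom z)).1 (congrArg (fun f => f.hom z) (Y.iCycles_d k (k + 1)))
      exact ⟨y, hinj k (by rw [hd, hy])⟩
  obtain ⟨-, -, hex, hsurj⟩ := hcycles i j k hij hjk
  obtain ⟨hinj', hex', -, hsurj'⟩ := hcycles j k (k + 1) hjk rfl
  refine (BalTensor.exact_map_left (K := K) _ _ hex hsurj x).1 ?_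
  apply (hZ (k + 1)).map_id_injective _ _ hinj' hex' hsurj' K
  rw [map_zero, BalTensor.map_map]
  rw [← Y.toCycles_i j k] at hx
  exact hx

/-! ### Maps from finitely generated free modules -/

/-- For `g : S → T` between finitely generated free modules and `K` the cokernel of
`Hom(T, R) → Hom(S, R)`, the group `K ⊗_R M` is the cokernel of `Hom(T, M) → Hom(S, M)`, naturally
in `M`. Hence if `Y` is pure exact, the complex `Coker(Hom(T, Y) → Hom(S, Y))` is exact. -/
lemma PureExact.exists_eq_comp_add_comp {Y : CochainComplex (ModuleCat.{u} R) ℤ} (hY : PureExact Y)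
    {S T : Type u} [AddCommGroup S] [Module R S] [AddCommGroup T] [Module R T]
    [Module.Free R S] [Module.Finite R S] [Module.Free R T] [Module.Finite R T]
    (g : S →ₗ[R] T) {i j k : ℤ} (hij : i + 1 = j) (hjk : j + 1 = k)
    (a : S →ₗ[R] Y.X j) (b : T →ₗ[R] Y.X k) (hab : (Y.d j k).hom ∘ₗ a = b ∘ₗ g) :
    ∃ (c : S →ₗ[R] Y.X i) (b' : T →ₗ[R] Y.X j), a = (Y.d i j).hom ∘ₗ c + b' ∘ₗ g := by
  classical
  let e := Module.Free.chooseBasis R S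
  let f := Module.Free.chooseBasis R T
  let W : Submodule Rᵐᵒᵖ (S →ₗ[R] R) := LinearMap.range (g.lcomp Rᵐᵒᵖ R)
  let K : ModuleCat.{u} Rᵐᵒᵖ := ModuleCat.of _ ((S →ₗ[R] R) ⧸ W)
  let q : (S →ₗ[R] R) →ₗ[Rᵐᵒᵖ] K := W.mkQ
  have hq : ∀ φ : T →ₗ[R] R, q (φ ∘ₗ g) = 0 := fun φ =>
    (Submodule.Quotient.mk_eq_zero W).2 ⟨φ, rfl⟩
  -- The class in `K ⊗ M` of a linear map `S → M`.
  let θ (M : Type u) [AddCommGroup M] [Module R M] (φ : S →ₗ[R] M) : BalTensor.Carrier R K M :=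
    ∑ s, BalTensor.tmul R (q (e.coord s)) (φ (e s))
  have hθ : ∀ (M : Type u) [AddCommGroup M] [Module R M] (φ : T →ₗ[R] M), θ M (φ ∘ₗ g) = 0 := by
    intro M _ _ φ
    have h1 : ∀ s, φ (g (e s)) = ∑ t, f.coord t (g (e s)) • φ (f t) := fun s => by
      conv_lhs => rw [← f.sum_repr (g (e s))]
      simp only [map_sum, map_smul, Module.Basis.coord_apply]
    have h2 : ∀ t, ∑ s, MulOpposite.op (f.coord t (g (e s))) • e.coord s = f.coord t ∘ₗ g := by
      intro t
      refine e.ext fun s => ?_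
      simp [LinearMap.sum_apply, Finsupp.single_apply]
    simp only [θ, LinearMap.comp_apply, h1, BalTensor.tmul_sum]
    rw [Finset.sum_comm]
    refine Finset.sum_eq_zero fun t _ => ?_
    simp only [← BalTensor.smul_tmul, ← map_smul q]
    rw [← BalTensor.sum_tmul, ← map_sum, h2, hq, BalTensor.zero_tmul]
  -- The map from `K ⊗ M` to the cokernel of `Hom(T, M) → Hom(S, M)`.
  let V (M : Type u) [AddCommGroup M] [Module R M] : AddSubgroup (S →ₗ[R] M) :=
    (LinearMap.range (g.lcomp ℤ M)).toAddSubgroup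
  have hΨ : ∀ (M : Type u) [AddCommGroup M] [Module R M],
      ∃ Ψ : BalTensor.Carrier R K M →+ (S →ₗ[R] M) ⧸ V M, ∀ φ m,
        Ψ (BalTensor.tmul R (q φ) m) = QuotientAddGroup.mk' (V M) (φ.smulRight m) := by
    intro M _ _
    let Φ : (S →ₗ[R] R) →+ M →+ (S →ₗ[R] M) ⧸ V M :=
      AddMonoidHom.mk' (fun φ => AddMonoidHom.mk'
        (fun m => QuotientAddGroup.mk' (V M) (φ.smulRight m))
        (fun m m' => by rw [← map_add]; congr 1; ext; simp))
        (fun φ φ' => by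
          ext m
          simp only [AddMonoidHom.mk'_apply, AddMonoidHom.add_apply]
          rw [← map_add]; congr 1; ext; simp [add_smul])
    let Φ' : K →+ M →+ (S →ₗ[R] M) ⧸ V M :=
      QuotientAddGroup.lift W.toAddSubgroup Φ (by
        rintro _ ⟨φ, rfl⟩
        ext m
        exact (QuotientAddGroup.eq_zero_iff _).2 ⟨φ.smulRight m, by ext; simp⟩)
    have hΦ' : ∀ φ, Φ' (q φ) = Φ φ := fun φ => rfl
    refine ⟨BalTensor.lift Φ' ?_, fun φ m => rfl⟩
    intro k r m
    obtain ⟨φ, rfl⟩ := W.mkQ_surjective k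
    change Φ' (MulOpposite.op r • q φ) m = Φ' (q φ) (r • m)
    rw [← map_smul, hΦ', hΦ']
    simp only [Φ, AddMonoidHom.mk'_apply]
    congr 1
    ext
    simp [mul_smul]
  choose Ψ hΨ using hΨ
  have hΨθ : Ψ _ (θ _ a) = QuotientAddGroup.mk' (V _) a := by
    simp only [θ, map_sum, hΨ]
    rw [← map_sum]
    congr 1
    refine e.ext fun s => ?_
    simp [LinearMap.sum_apply, Finsupp.single_apply]
  have hθa : BalTensor.map (LinearMap.id : K →ₗ[Rᵐᵒᵖ] K) (Y.d j k).hom (θ _ a) = 0 := by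
    rw [← hθ _ b, ← hab]
    simp [θ]
  obtain ⟨t, ht⟩ := (pureExact_iff Y).1 hY K i j k hij hjk _ hθa
  have hnat : ∀ t, ∃ c : S →ₗ[R] Y.X i,
      Ψ _ (BalTensor.map (LinearMap.id : K →ₗ[Rᵐᵒᵖ] K) (Y.d i j).hom t) =
        QuotientAddGroup.mk' (V _) ((Y.d i j).hom ∘ₗ c) := by
    intro t
    induction t using BalTensor.induction with
    | zero => exact ⟨0, by simp⟩
    | tmul κ m =>
      obtain ⟨φ, rfl⟩ := W.mkQ_surjective κ
      refine ⟨φ.smulRight m, ?_⟩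
      rw [BalTensor.map_tmul]
      refine (hΨ _ φ _).trans ?_
      congr 1
      ext
      simp
    | add x y hx hy =>
      obtain ⟨c, hc⟩ := hx
      obtain ⟨c', hc'⟩ := hy
      exact ⟨c + c', by rw [map_add, map_add, hc, hc', ← map_add, LinearMap.comp_add]⟩
  obtain ⟨c, hc⟩ := hnat t
  rw [ht, hΨθ, ← sub_eq_zero, ← map_sub] at hc
  obtain ⟨b', hb'⟩ := (QuotientAddGroup.eq_zero_iff _).1 hc
  exact ⟨c, b', by rw [← sub_eq_iff_eq_add']; exact hb'.symm⟩

/-! ### Bounded below complexes of finitely generated free modules -/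

/-- Dependent choice for sequences indexed by `ℤ`, when the relation holds trivially below `M`. -/
lemma exists_int_seq {X : ℤ → Type*} (r : ∀ n, X n → X (n + 1) → Prop) (M : ℤ)
    (h₀ : ∀ n ≤ M, Nonempty (X n)) (h : ∀ n, M ≤ n → ∀ x, ∃ y, r n x y)
    (h' : ∀ n < M, ∀ x y, r n x y) : ∃ x : ∀ n, X n, ∀ n, r n (x n) (x (n + 1)) := by
  choose next hnext using h
  let x : ∀ n, X n := fun n => n.inductionOn' M (h₀ M le_rfl).some
    (fun k hk => next k hk) (fun k hk _ => (h₀ (k - 1) (by lia)).some)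
  refine ⟨x, fun n => ?_⟩
  rcases lt_or_ge n M with hn | hn
  · exact h' n hn _ _
  · have : x (n + 1) = next n hn (x n) := Int.inductionOn'_add_one hn
    rw [this]
    exact hnext n hn _

/-- A chain map from a bounded below complex of finitely generated free modules to a pure exact
complex is null-homotopic. The homotopy `s` is built degree by degree, requiring that the error
`f - d s` is in each degree divisible by the differential on the right; this makes the next step
possible. -/
lemma PureExact.exists_homotopy_of_finite {Y : CochainComplex (ModuleCat.{u} R) ℤ}
    (hY : PureExact Y) (S : ℤ → Type u) [∀ n, AddCommGroup (S n)] [∀ n, Module R (S n)]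
    [∀ n, Module.Free R (S n)] [∀ n, Module.Finite R (S n)]
    (D : ∀ n, S n →ₗ[R] S (n + 1)) (hD : ∀ n, D (n + 1) ∘ₗ D n = 0)
    (N : ℤ) (hN : ∀ n < N, Subsingleton (S n)) (f : ∀ n, S (n + 1) →ₗ[R] Y.X (n + 1))
    (hf : ∀ n, (Y.d (n + 1) (n + 1 + 1)).hom ∘ₗ f n = f (n + 1) ∘ₗ D (n + 1)) :
    ∃ s : ∀ n, S (n + 1) →ₗ[R] Y.X n,
      ∀ n, f n = (Y.d n (n + 1)).hom ∘ₗ s n + s (n + 1) ∘ₗ D (n + 1) := by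
  have hdd : ∀ (i j k : ℤ) (x : Y.X i), (Y.d j k).hom ((Y.d i j).hom x) = 0 := fun i j k x =>
    congrArg (fun φ => φ.hom x) (Y.d_comp_d i j k)
  have hDx : ∀ n x, D (n + 1) (D n x) = 0 := fun n x => LinearMap.congr_fun (hD n) x
  have hfx : ∀ n x, (Y.d (n + 1) (n + 1 + 1)).hom (f n x) = f (n + 1) (D (n + 1) x) := fun n x =>
    LinearMap.congr_fun (hf n) x
  let X : ℤ → Type u := fun n => {s : S (n + 1) →ₗ[R] Y.X n //
    ∃ b : S (n + 1 + 1) →ₗ[R] Y.X (n + 1),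
      f n = (Y.d n (n + 1)).hom ∘ₗ s + b ∘ₗ D (n + 1)}
  let r : ∀ n, X n → X (n + 1) → Prop := fun n s s' =>
    f n = (Y.d n (n + 1)).hom ∘ₗ s.1 + s'.1 ∘ₗ D (n + 1)
  obtain ⟨s, hs⟩ := exists_int_seq r (N - 2) (fun n hn => by
      have := hN (n + 1) (by lia)
      exact ⟨0, 0, LinearMap.ext fun x => by simp [Subsingleton.elim x 0]⟩)
    (fun n _ ⟨s, b, hb⟩ => by
      have hbx : ∀ x, f n x = (Y.d n (n + 1)).hom (s x) + b (D (n + 1) x) :=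
        fun x => LinearMap.congr_fun hb x
      let w : S (n + 1 + 1) →ₗ[R] Y.X (n + 1 + 1) :=
        f (n + 1) - (Y.d (n + 1) (n + 1 + 1)).hom ∘ₗ b
      have hw : ∀ x, w (D (n + 1) x) = 0 := fun x => by
        have := hfx n x
        rw [hbx, map_add, hdd, zero_add] at this
        simp [w, this]
      obtain ⟨c, b', hcb⟩ := hY.exists_eq_comp_add_comp (D (n + 1 + 1)) rfl rfl w
        (f (n + 1 + 1)) (LinearMap.ext fun x => by simp [w, hdd, hfx])
      have hcbx : ∀ x, w x = (Y.d (n + 1) (n + 1 + 1)).hom (c x) + b' (D (n + 1 + 1) x) :=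
        fun x => LinearMap.congr_fun hcb x
      have hcD : ∀ x, (Y.d (n + 1) (n + 1 + 1)).hom (c (D (n + 1) x)) = 0 := fun x => by
        have := hcbx (D (n + 1) x)
        rwa [hw, hDx, map_zero, add_zero, eq_comm] at this
      -- Correct `c` by a boundary so that it vanishes on the image of `D (n + 1)`.
      obtain ⟨e, z, hez⟩ := hY.exists_eq_comp_add_comp (0 : S (n + 1) →ₗ[R] S (n + 1))
        (i := n) (j := n + 1) rfl rfl (c ∘ₗ D (n + 1)) 0 (LinearMap.ext fun x => by simp [hcD])
      have hex : ∀ x, c (D (n + 1) x) = (Y.d n (n + 1)).hom (e x) := fun x => by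
        simpa using LinearMap.congr_fun hez x
      obtain ⟨e', c', hec⟩ := hY.exists_eq_comp_add_comp (D (n + 1)) (i := n - 1) (j := n)
        (by lia) rfl e c (LinearMap.ext fun x => by simp [hex])
      have hecx : ∀ x, e x = (Y.d (n - 1) n).hom (e' x) + c' (D (n + 1) x) :=
        fun x => LinearMap.congr_fun hec x
      refine ⟨⟨b + c - (Y.d n (n + 1)).hom ∘ₗ c', b', LinearMap.ext fun x => ?_⟩,
        LinearMap.ext fun x => ?_⟩
      · have := hcbx x
        simp only [w, LinearMap.sub_apply, LinearMap.comp_apply, LinearMap.add_apply, map_sub,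
          map_add, hdd, sub_zero] at this ⊢
        rw [sub_eq_iff_eq_add] at this
        rw [this]
        abel
      · simp only [LinearMap.sub_apply, LinearMap.comp_apply, LinearMap.add_apply, hbx, hex, hecx,
          map_add, hdd, zero_add, add_sub_cancel_right])
    (fun n hn s s' => by
      have := hN (n + 1) (by lia)
      exact LinearMap.ext fun x => by simp [Subsingleton.elim x 0])
  exact ⟨fun n => (s n).1, hs⟩

/-! ### Complexes of free modules -/

section

variable {B : ℤ → Type u} (D : ∀ n, (B n →₀ R) →ₗ[R] (B (n + 1) →₀ R))

/-- The smallest family of subsets of the bases which contains the element `b₀` of degree `N` and is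
closed under passing from a basis element to those in the support of its differential. It spans a
subcomplex. -/
inductive GeneratedBy {N : ℤ} (b₀ : B N) : ∀ n, B n → Prop
  | base : GeneratedBy b₀ N b₀
  | step {n : ℤ} {b : B n} {b' : B (n + 1)} (h : GeneratedBy b₀ n b)
      (h' : b' ∈ (D n (Finsupp.single b 1)).support) : GeneratedBy b₀ (n + 1) b'

variable {D}

lemma GeneratedBy.le {N : ℤ} {b₀ : B N} {n : ℤ} {b : B n} (h : GeneratedBy D b₀ n b) : N ≤ n := by
  induction h with
  | base => exact le_rfl
  | step _ _ ih => lia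

lemma GeneratedBy.finite {N : ℤ} (b₀ : B N) (n : ℤ) : {b | GeneratedBy D b₀ n b}.Finite := by
  rcases lt_or_ge n N with hn | hn
  · convert Set.finite_empty
    ext b
    simpa using fun h : GeneratedBy D b₀ n b => absurd h.le (not_le.2 hn)
  induction n, hn using Int.leInduction with
  | base =>
    refine (Set.finite_singleton b₀).subset fun b hb => ?_
    have : ∀ n (b : B n), GeneratedBy D b₀ n b → ∀ h : n = N, h ▸ b = b₀ := by
      intro n b hb
      cases hb with
      | base => intro _; rfl
      | step h h' => intro h2; exact absurd h.le (by lia)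
    exact this N b hb rfl
  | succ n hn ih =>
    refine (ih.biUnion fun b _ => (D n (Finsupp.single b 1)).support.finite_toSet).subset
      fun b hb => ?_
    have : ∀ m (b : B m), GeneratedBy D b₀ m b → ∀ h : m = n + 1,
        ∃ c, GeneratedBy D b₀ n c ∧ h ▸ b ∈ (D n (Finsupp.single c 1)).support := by
      intro m b hb
      cases hb with
      | base => intro h; lia
      | @step k c _ h h' =>
        intro h2
        obtain rfl : k = n := by lia
        exact ⟨c, h, h'⟩
    obtain ⟨c, hc, hb⟩ := this _ b hb rfl
    exact Set.mem_biUnion hc hb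

lemma Finsupp.eqOn_supported {B : Type*} {M : Type*} [AddCommGroup M] [Module R M] {T : Set B}
    {φ ψ : (B →₀ R) →ₗ[R] M} (h : ∀ b ∈ T, φ (single b 1) = ψ (single b 1)) {x : B →₀ R}
    (hx : x ∈ supported R R T) : φ x = ψ x := by
  rw [supported_eq_span_single] at hx
  refine LinearMap.eqOn_span ?_ hx
  rintro _ ⟨b, hb, rfl⟩
  exact h b hb

lemma Finsupp.map_mem_of_mem_supported {B : Type*} {M : Type*} [AddCommGroup M] [Module R M]
    {T : Set B} {φ : (B →₀ R) →ₗ[R] M} {V : Submodule R M} (h : ∀ b ∈ T, φ (single b 1) ∈ V)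
    {x : B →₀ R} (hx : x ∈ supported R R T) : φ x ∈ V := by
  rw [supported_eq_span_single] at hx
  refine (Submodule.span_le (p := V.comap φ)).2 ?_ hx
  rintro _ ⟨b, hb, rfl⟩
  exact h b hb

variable (D) {Y : CochainComplex (ModuleCat.{u} R) ℤ} (f : ∀ n, (B n →₀ R) →ₗ[R] Y.X n)

/-- A null-homotopy of a chain map `f`, defined on the subcomplex spanned by a family of subsets
of the bases. The maps `s n` are defined everywhere, but only their values on this subcomplex are
relevant. -/
structure PartialHomotopy where
  /-- The part of the bases on which the homotopy is defined. -/
  T : ∀ n, Set (B n)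
  /-- The homotopy. -/
  s : ∀ n, (B (n + 1) →₀ R) →ₗ[R] Y.X n
  closed : ∀ n, ∀ b ∈ T n, D n (Finsupp.single b 1) ∈ Finsupp.supported R R (T (n + 1))
  homotopy : ∀ n, ∀ b ∈ T (n + 1), f (n + 1) (Finsupp.single b 1) =
    (Y.d n (n + 1)).hom (s n (Finsupp.single b 1)) + s (n + 1) (D (n + 1) (Finsupp.single b 1))

variable {D f}

namespace PartialHomotopy

/-- The relation `q.Extends p` says that the partial homotopy `q` extends `p`. -/
def Extends (q p : PartialHomotopy D f) : Prop :=
  ∀ n, p.T n ⊆ q.T n ∧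
    ∀ b ∈ p.T (n + 1), q.s n (Finsupp.single b 1) = p.s n (Finsupp.single b 1)

lemma Extends.trans {p q r : PartialHomotopy D f} (h : q.Extends p) (h' : r.Extends q) :
    r.Extends p := by
  intro n
  exact ⟨(h n).1.trans (h' n).1, fun b hb =>
    ((h' n).2 b ((h (n + 1)).1 hb)).trans ((h n).2 b hb)⟩

lemma exists_upper_bound (c : Set (PartialHomotopy D f))
    (hc : IsChain (fun p q => q.Extends p) c) :
    ∃ q : PartialHomotopy D f, ∀ p ∈ c, q.Extends p := by
  classical
  let s : ∀ n, B (n + 1) → Y.X n := fun n b =>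
    if h : ∃ p ∈ c, b ∈ p.T (n + 1) then h.choose.s n (Finsupp.single b 1) else 0
  let S : ∀ n, (B (n + 1) →₀ R) →ₗ[R] Y.X n := fun n => Finsupp.linearCombination R (s n)
  have hS : ∀ p ∈ c, ∀ n, ∀ b ∈ p.T (n + 1),
      S n (Finsupp.single b 1) = p.s n (Finsupp.single b 1) := by
    intro p hp n b hb
    have h : ∃ p ∈ c, b ∈ p.T (n + 1) := ⟨p, hp, hb⟩
    have h1 : S n (Finsupp.single b 1) = h.choose.s n (Finsupp.single b 1) := by
      simp only [S, Finsupp.linearCombination_single, one_smul, s]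
      rw [dif_pos h]
    rw [h1]
    by_cases heq : h.choose = p
    · rw [heq]
    · rcases hc h.choose_spec.1 hp heq with h' | h'
      · exact ((h' n).2 b h.choose_spec.2).symm
      · exact (h' n).2 b hb
  refine ⟨⟨fun n => ⋃ p ∈ c, p.T n, S, ?_, ?_⟩, fun p hp n =>
    ⟨Set.subset_biUnion_of_mem (u := fun p : PartialHomotopy D f => p.T n) hp, hS p hp n⟩⟩
  · intro n b hb
    obtain ⟨p, hp, hb⟩ := Set.mem_iUnion₂.1 hb
    exact Finsupp.supported_mono
      (Set.subset_biUnion_of_mem (u := fun p : PartialHomotopy D f => p.T (n + 1)) hp)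
      (p.closed n b hb)
  · intro n b hb
    obtain ⟨p, hp, hb⟩ := Set.mem_iUnion₂.1 hb
    rw [hS p hp n b hb, Finsupp.eqOn_supported (hS p hp (n + 1)) (p.closed _ b hb)]
    exact p.homotopy n b hb

/-- A partial homotopy extends to any further basis element `b₀`: the quotient of the subcomplex
generated by `b₀` and the domain by the domain is a bounded below complex of finitely generated
free modules. -/
lemma exists_extends (hY : PureExact Y) (hD : ∀ n, D (n + 1) ∘ₗ D n = 0)
    (hf : ∀ n, (Y.d n (n + 1)).hom ∘ₗ f n = f (n + 1) ∘ₗ D n)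
    (p : PartialHomotopy D f) {N : ℤ} (b₀ : B N) :
    ∃ q : PartialHomotopy D f, q.Extends p ∧ b₀ ∈ q.T N := by
  classical
  have hdd : ∀ (i j k : ℤ) (x : Y.X i), (Y.d j k).hom ((Y.d i j).hom x) = 0 := fun i j k x =>
    congrArg (fun φ => φ.hom x) (Y.d_comp_d i j k)
  have hDx : ∀ n x, D (n + 1) (D n x) = 0 := fun n x => LinearMap.congr_fun (hD n) x
  have hfx : ∀ n x, (Y.d n (n + 1)).hom (f n x) = f (n + 1) (D n x) := fun n x =>
    LinearMap.congr_fun (hf n) x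
  let W : ∀ n, Set (B n) := fun n => {b | GeneratedBy D b₀ n b ∧ b ∉ p.T n}
  let T' : ∀ n, Set (B n) := fun n => {b | GeneratedBy D b₀ n b ∨ b ∈ p.T n}
  have hWfin : ∀ n, Finite (W n) := fun n =>
    ((GeneratedBy.finite b₀ n).subset fun b hb => hb.1).to_subtype
  let ι : ∀ n, (W n →₀ R) →ₗ[R] (B n →₀ R) := fun n => Finsupp.lmapDomain R R Subtype.val
  let π : ∀ n, (B n →₀ R) →ₗ[R] (W n →₀ R) := fun n => Finsupp.lsubtypeDomain (W n)
  have hπT : ∀ n, ∀ x ∈ Finsupp.supported R R (p.T n), π n x = 0 := by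
    intro n x hx
    ext b
    by_contra hb
    exact b.2.2 (hx (Finsupp.mem_support_iff.2 hb))
  have hιπ : ∀ n, ∀ x ∈ Finsupp.supported R R (T' n),
      x - ι n (π n x) ∈ Finsupp.supported R R (p.T n) := by
    intro n x hx b hb
    by_contra hbT
    refine Finsupp.mem_support_iff.1 hb ?_
    rw [Finsupp.sub_apply, sub_eq_zero]
    by_cases hbW : b ∈ W n
    · exact (Finsupp.mapDomain_apply (f := Subtype.val) Subtype.val_injective (π n x)
        ⟨b, hbW⟩).symm
    · rw [show ι n (π n x) b = 0 from Finsupp.mapDomain_of_notMem_range _ _ (by simpa using hbW)]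
      by_contra hxb
      rcases hx (Finsupp.mem_support_iff.2 hxb) with h | h
      · exact hbW ⟨h, hbT⟩
      · exact hbT h
  have hι : ∀ n x, ι n x ∈ Finsupp.supported R R (T' n) := by
    intro n x b hb
    by_contra hbT
    exact Finsupp.mem_support_iff.1 hb (Finsupp.mapDomain_of_notMem_range _ _ (by
      rintro ⟨b, rfl⟩
      exact hbT (Or.inl b.2.1)))
  have hπι : ∀ n x, π n (ι n x) = x := fun n x => by
    ext b
    exact Finsupp.mapDomain_apply Subtype.val_injective _ b
  have hT : ∀ n, ∀ x ∈ Finsupp.supported R R (p.T n),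
      D n x ∈ Finsupp.supported R R (p.T (n + 1)) := fun n x hx =>
    Finsupp.map_mem_of_mem_supported (p.closed n) hx
  have hT'b : ∀ n, ∀ b ∈ T' n, D n (Finsupp.single b 1) ∈ Finsupp.supported R R (T' (n + 1)) := by
    rintro n b (hb | hb)
    · exact fun b' hb' => Or.inl (hb.step hb')
    · exact Finsupp.supported_mono (fun _ => Or.inr) (p.closed n b hb)
  have hT' : ∀ n, ∀ x ∈ Finsupp.supported R R (T' n),
      D n x ∈ Finsupp.supported R R (T' (n + 1)) := fun n x hx =>
    Finsupp.map_mem_of_mem_supported (hT'b n) hx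
  have hπD : ∀ n, ∀ x ∈ Finsupp.supported R R (T' n),
      π (n + 1) (D n (ι n (π n x))) = π (n + 1) (D n x) := by
    intro n x hx
    have := hπT _ _ (hT n _ (hιπ n x hx))
    rw [map_sub, map_sub, sub_eq_zero] at this
    exact this.symm
  -- The error of the homotopy; it vanishes on the span of `p.T`.
  let f' : ∀ n, (B (n + 1) →₀ R) →ₗ[R] Y.X (n + 1) := fun n =>
    f (n + 1) - (Y.d n (n + 1)).hom ∘ₗ p.s n - p.s (n + 1) ∘ₗ D (n + 1)
  have hf'T : ∀ n, ∀ x ∈ Finsupp.supported R R (p.T (n + 1)), f' n x = 0 := fun n x hx =>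
    Finsupp.eqOn_supported (φ := f' n) (ψ := 0) (fun b hb => by simp [f', p.homotopy n b hb]) hx
  have hf'π : ∀ n, ∀ x ∈ Finsupp.supported R R (T' (n + 1)),
      f' n (ι (n + 1) (π (n + 1) x)) = f' n x := by
    intro n x hx
    have := hf'T _ _ (hιπ (n + 1) x hx)
    rw [map_sub, sub_eq_zero] at this
    exact this.symm
  obtain ⟨t, ht⟩ := hY.exists_homotopy_of_finite (fun n => W n →₀ R)
    (fun n => π (n + 1) ∘ₗ D n ∘ₗ ι n)
    (fun n => LinearMap.ext fun x => by
      simp only [LinearMap.comp_apply, LinearMap.zero_apply]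
      rw [hπD _ _ (hT' _ _ (hι n x)), hDx, map_zero])
    N (fun n hn => by
      have : IsEmpty (W n) := ⟨fun b => absurd b.2.1.le (not_le.2 hn)⟩
      infer_instance)
    (fun n => f' n ∘ₗ ι (n + 1))
    (fun n => LinearMap.ext fun x => by
      simp only [LinearMap.comp_apply]
      rw [hf'π _ _ (hT' _ _ (hι _ x))]
      simp [f', hdd, hDx, hfx])
  have htx : ∀ n x, f' n (ι (n + 1) x) = (Y.d n (n + 1)).hom (t n x) +
      t (n + 1) (π (n + 1 + 1) (D (n + 1) (ι (n + 1) x))) := fun n x =>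
    LinearMap.congr_fun (ht n) x
  refine ⟨⟨T', fun n => p.s n + t n ∘ₗ π (n + 1), hT'b, ?_⟩, ?_, Or.inl .base⟩
  · intro n b hb
    have hx : Finsupp.single b 1 ∈ Finsupp.supported R R (T' (n + 1)) :=
      Finsupp.single_mem_supported R 1 hb
    have h1 := htx n (π (n + 1) (Finsupp.single b 1))
    rw [hf'π _ _ hx, hπD _ _ hx] at h1
    simp only [f', LinearMap.sub_apply, LinearMap.comp_apply, LinearMap.add_apply, map_add,
      sub_eq_iff_eq_add] at h1 ⊢
    rw [h1]
    abel
  · refine fun n => ⟨fun b => Or.inr, fun b hb => ?_⟩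
    simp [hπT _ _ (Finsupp.single_mem_supported R 1 hb)]

end PartialHomotopy

/-- A chain map from a complex of free modules to a pure exact complex is null-homotopic. -/
lemma PureExact.exists_homotopy_of_free (hY : PureExact Y) (hD : ∀ n, D (n + 1) ∘ₗ D n = 0)
    (hf : ∀ n, (Y.d n (n + 1)).hom ∘ₗ f n = f (n + 1) ∘ₗ D n) :
    ∃ s : ∀ n, (B (n + 1) →₀ R) →ₗ[R] Y.X n,
      ∀ n, f (n + 1) = (Y.d n (n + 1)).hom ∘ₗ s n + s (n + 1) ∘ₗ D (n + 1) := by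
  obtain ⟨m, hm⟩ := exists_maximal_of_chains_bounded
    (r := fun p q : PartialHomotopy D f => q.Extends p) PartialHomotopy.exists_upper_bound
    (fun h h' => h.trans h')
  refine ⟨m.s, fun n => Finsupp.lhom_ext' fun b => LinearMap.ext_ring ?_⟩
  obtain ⟨q, hq, hb⟩ := m.exists_extends hY hD hf b
  exact m.homotopy n b ((hm q hq _).1 hb)

end

/-! ### Complexes of projective modules -/

/-- A complex `(C, d)` of projective modules is a retract of a complex of free modules: if `C n` is
a retract of a free module `F n` via `i n` and `p n`, then the maps `i ∘ d ∘ p` turn `F` into a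
complex, for which `i` and `p` are chain maps. So the claim follows from the case of complexes of
free modules. -/
theorem PureExact.nonempty_homotopy_zero {C Y : CochainComplex (ModuleCat.{u} R) ℤ}
    (hC : ∀ n, Module.Projective R (C.X n)) (hY : PureExact Y) (f : C ⟶ Y) :
    Nonempty (Homotopy f 0) := by
  let p : ∀ n, (C.X n →₀ R) →ₗ[R] C.X n := fun n => Finsupp.linearCombination R id
  choose i hi using fun n => (hC n).out
  replace hi : ∀ n x, p n (i n x) = x := hi
  have hdd : ∀ (i j k : ℤ) (x : C.X i), (C.d j k).hom ((C.d i j).hom x) = 0 := fun i j k x =>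
    congrArg (fun φ => φ.hom x) (C.d_comp_d i j k)
  have hf : ∀ j k x, (Y.d j k).hom ((f.f j).hom x) = (f.f k).hom ((C.d j k).hom x) := fun j k x =>
    congrArg (fun φ => φ.hom x) (f.comm j k)
  obtain ⟨s, hs⟩ := hY.exists_homotopy_of_free (B := fun n => C.X n)
    (D := fun n => i (n + 1) ∘ₗ (C.d n (n + 1)).hom ∘ₗ p n) (f := fun n => (f.f n).hom ∘ₗ p n)
    (fun n => LinearMap.ext fun x => by simp [hi, hdd])
    (fun n => LinearMap.ext fun x => by simp [hi, hf])
  refine ⟨{ hom := fun j k => if h : k + 1 = j then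
              (C.XIsoOfEq h.symm).hom ≫ ModuleCat.ofHom (s k ∘ₗ i (k + 1)) else 0
            zero := fun j k h => dif_neg h
            comm := fun j => ?_ }⟩
  obtain ⟨n, rfl⟩ : ∃ n, j = n + 1 := ⟨j - 1, by lia⟩
  rw [dNext_eq _ (show (ComplexShape.up ℤ).Rel (n + 1) (n + 1 + 1) from rfl),
    prevD_eq _ (show (ComplexShape.up ℤ).Rel n (n + 1) from rfl), dif_pos rfl, dif_pos rfl]
  ext x
  have := LinearMap.congr_fun (hs n) (i (n + 1) x)
  simp only [LinearMap.comp_apply, LinearMap.add_apply, hi] at this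
  simp [this, add_comm]

lemma PureExact.shift {Y : CochainComplex (ModuleCat.{u} R) ℤ} (hY : PureExact Y) (n : ℤ) :
    PureExact (Y⟦n⟧) := by
  rw [pureExact_iff] at hY ⊢
  intro K i j k hij hjk
  have hneg : ∀ {M P : ModuleCat.{u} R} (g : M ⟶ P) (x : BalTensor.Carrier R K M),
      BalTensor.map (LinearMap.id : K →ₗ[Rᵐᵒᵖ] K) (-g).hom x =
        -BalTensor.map (LinearMap.id : K →ₗ[Rᵐᵒᵖ] K) g.hom x := by
    intro M P g x
    rw [eq_neg_iff_add_eq_zero, ← AddMonoidHom.add_apply, ← BalTensor.map_add_right]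
    rw [← ModuleCat.hom_add, neg_add_cancel]
    induction x using BalTensor.induction with
    | zero => simp
    | tmul k m => simp
    | add x y hx hy => rw [map_add, hx, hy, add_zero]
  have key := hY K (i + n) (j + n) (k + n) (by lia) (by lia)
  intro (x : BalTensor.Carrier R K (Y.X (j + n))) hx
  rcases Int.units_eq_one_or n.negOnePow with h | h
  · have h1 : ∀ a b, (Y⟦n⟧).d a b = Y.d (a + n) (b + n) := fun a b => by
      rw [CochainComplex.shiftFunctor_obj_d', h, one_smul]
    rw [h1] at hx ⊢
    exact key x hx
  · have h1 : ∀ a b (y : BalTensor.Carrier R K (Y.X (a + n))),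
        BalTensor.map (LinearMap.id : K →ₗ[Rᵐᵒᵖ] K) ((Y⟦n⟧).d a b).hom y =
          -BalTensor.map (LinearMap.id : K →ₗ[Rᵐᵒᵖ] K) (Y.d (a + n) (b + n)).hom y := by
      intro a b y
      have h2 : (Y⟦n⟧).d a b = -Y.d (a + n) (b + n) := by
        rw [CochainComplex.shiftFunctor_obj_d', h]
        exact (Units.neg_smul 1 _).trans (congrArg Neg.neg (one_smul ℤˣ _))
      rw [h2]
      exact hneg _ y
    obtain ⟨y, hy⟩ := key x (neg_eq_zero.1 ((h1 j k x).symm.trans hx))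
    exact ⟨-y, (map_neg _ y).trans ((congrArg _ (h1 i j y)).trans ((neg_neg _).trans hy))⟩

open CochainComplex.HomComplex in
theorem PureExact.mem_coboundaries {C Y : CochainComplex (ModuleCat.{u} R) ℤ}
    (hC : ∀ n, Module.Projective R (C.X n)) (hY : PureExact Y) {n : ℤ} (z : Cocycle C Y n) :
    z ∈ coboundaries C Y n := by
  rw [← CohomologyClass.toHom_mk_eq_zero_iff, CohomologyClass.toHom_mk,
    HomotopyCategory.quotient_map_eq_zero_iff]
  exact (hY.shift n).nonempty_homotopy_zero hC _

open CochainComplex.HomComplex in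
theorem PureExact.acyclic_homComplex {C Y : CochainComplex (ModuleCat.{u} R) ℤ}
    (hC : ∀ n, Module.Projective R (C.X n)) (hY : PureExact Y) :
    (CochainComplex.HomComplex C Y).Acyclic := by
  intro n
  rw [HomologicalComplex.exactAt_iff_isZero_homology, AddCommGrpCat.isZero_iff_subsingleton]
  refine (homologyAddEquiv C Y n).toEquiv.subsingleton_congr.2 ⟨fun x y => ?_⟩
  obtain ⟨x, rfl⟩ := x.mk_surjective
  obtain ⟨y, rfl⟩ := y.mk_surjective
  rw [(CohomologyClass.mk_eq_zero_iff x).2 (hY.mem_coboundaries hC x),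
    (CohomologyClass.mk_eq_zero_iff y).2 (hY.mem_coboundaries hC y)]

/-! ### Vanishing of `Ext¹` -/

open CochainComplex.HomComplex in
/-- If `C` is a complex of projective modules, every morphism `C ⟶ S.X₃` lifts to `S.X₂` degreewise.
The obstruction to lifting it as a chain map is a cocycle of degree `1` with values in `S.X₁`. -/
lemma CochainComplex.exists_lift_of_projective
    {C : CochainComplex (ModuleCat.{u} R) ℤ} (hC : ∀ n, Module.Projective R (C.X n))
    {S : ShortComplex (CochainComplex (ModuleCat.{u} R) ℤ)} (hS : S.ShortExact)
    (h : ∀ z : Cocycle C S.X₁ 1, z ∈ coboundaries C S.X₁ 1) (φ : C ⟶ S.X₃) :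
    ∃ ψ : C ⟶ S.X₂, ψ ≫ S.g = φ := by
  have hSn : ∀ n, (S.map (HomologicalComplex.eval _ _ n)).ShortExact := fun n =>
    hS.map_of_exact _
  have hmono : ∀ n, Mono (S.map (HomologicalComplex.eval _ _ n)).f := fun n => (hSn n).mono_f
  have hlift : ∀ n, ∃ l : C.X n ⟶ S.X₂.X n, l ≫ S.g.f n = φ.f n := fun n => by
    have := hC n
    obtain ⟨l, hl⟩ := Module.projective_lifting_property (S.g.f n).hom (φ.f n).hom
      ((ModuleCat.epi_iff_surjective _).1 (hSn n).epi_g)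
    exact ⟨ModuleCat.ofHom l, ModuleCat.hom_ext hl⟩
  choose l hl using hlift
  let L : Cochain C S.X₂ 0 := Cochain.ofHoms l
  have hL : L.comp (Cochain.ofHom S.g) (add_zero 0) = Cochain.ofHom φ := by
    ext n
    simp [L, hl]
  have hδL : (δ 0 1 L).comp (Cochain.ofHom S.g) (add_zero 1) = 0 := by
    rw [← δ_comp_ofHom, hL, δ_ofHom]
  have hδLv : ∀ p q hpq, (δ 0 1 L).v p q hpq ≫ S.g.f q = 0 := fun p q hpq => by
    simpa using Cochain.congr_v hδL p q hpq
  let z : Cochain C S.X₁ 1 := Cochain.mk fun p q hpq =>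
    (hSn q).exact.lift ((δ 0 1 L).v p q hpq) (hδLv p q hpq)
  have hz : z.comp (Cochain.ofHom S.f) (add_zero 1) = δ 0 1 L := by
    ext p q hpq : 1
    rw [Cochain.comp_zero_cochain_v, Cochain.ofHom_v]
    exact (hSn q).exact.lift_f _ _
  have hinj : ∀ {m : ℤ} (w : Cochain C S.X₁ m),
      w.comp (Cochain.ofHom S.f) (add_zero m) = 0 → w = 0 := by
    intro m w hw
    ext p q hpq : 1
    have : Mono (S.f.f q) := hmono q
    rw [← cancel_mono (S.f.f q)]
    simpa using Cochain.congr_v hw p q hpq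
  have hδz : δ 1 2 z = 0 := hinj _ (by rw [← δ_comp_ofHom, hz, δ_δ])
  obtain ⟨w, hw⟩ := (mem_coboundaries_iff _ 0 (zero_add 1)).1 (h (Cocycle.mk z 2 rfl hδz))
  replace hw : δ 0 1 w = z := hw
  let ψ : Cocycle C S.X₂ 0 := Cocycle.mk (L - w.comp (Cochain.ofHom S.f) (add_zero 0)) 1
    (zero_add 1) (by rw [δ_sub, δ_comp_ofHom, hw, hz, sub_self])
  refine ⟨Cocycle.homOf ψ, ?_⟩
  ext n : 1
  have hfg : S.f.f n ≫ S.g.f n = 0 := by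
    rw [← HomologicalComplex.comp_f, S.zero, HomologicalComplex.zero_f]
  simp [ψ, L, hl, hfg]

theorem PureExact.subsingleton_ext_one {C Y : CochainComplex (ModuleCat.{u} R) ℤ}
    (hC : ∀ n, Module.Projective R (C.X n)) (hY : PureExact Y) :
    Subsingleton (Abelian.Ext.{u} C Y 1) := by
  let S : ShortComplex (CochainComplex (ModuleCat.{u} R) ℤ) :=
    ShortComplex.mk (Injective.ι Y) (cokernel.π (Injective.ι Y)) (cokernel.condition _)
  have hS : S.ShortExact :=
    { exact := ShortComplex.exact_cokernel _
      mono_f := inferInstanceAs (Mono (Injective.ι Y))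
      epi_g := inferInstanceAs (Epi (cokernel.π (Injective.ι Y))) }
  have : Injective S.X₂ := inferInstanceAs (Injective (Injective.under Y))
  suffices h : ∀ α : Abelian.Ext.{u} C Y 1, α = 0 from ⟨fun α β => by rw [h α, h β]⟩
  intro α
  obtain ⟨x, rfl⟩ := Abelian.Ext.covariant_sequence_exact₁ C hS α
    (Abelian.Ext.eq_zero_of_injective (n := 0) _) (zero_add 1)
  obtain ⟨φ, rfl⟩ := (Abelian.Ext.mk₀_bijective _ _).2 x
  obtain ⟨ψ, rfl⟩ := CochainComplex.exists_lift_of_projective hC hS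
    (fun z => hY.mem_coboundaries hC z) φ
  rw [← Abelian.Ext.mk₀_comp_mk₀, Abelian.Ext.comp_assoc_of_second_deg_zero, hS.comp_extClass,
    Abelian.Ext.comp_zero]

/-! ### Tensor products with pure exact complexes of right modules -/

/-- For a linear map `g : M → P` with cokernel `Q`, the complexes `Z ⊗ M`, `Z ⊗ P` and `Z ⊗ Q` are
exact, so the kernel of `Z ⊗ M → Z ⊗ P` is exact as well. -/
lemma PureExactRight.exists_of_map_eq_zero {Z : CochainComplex (ModuleCat.{u} Rᵐᵒᵖ) ℤ}
    (hZ : PureExactRight Z) {M P : Type u} [AddCommGroup M] [Module R M] [AddCommGroup P]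
    [Module R P] (g : M →ₗ[R] P) {i j k : ℤ} (hij : i + 1 = j) (hjk : j + 1 = k)
    (x : BalTensor.Carrier R (Z.X j) M)
    (hx : BalTensor.map (Z.d j k).hom (LinearMap.id : M →ₗ[R] M) x = 0)
    (hgx : BalTensor.map (LinearMap.id : Z.X j →ₗ[Rᵐᵒᵖ] Z.X j) g x = 0) :
    ∃ y : BalTensor.Carrier R (Z.X i) M,
      BalTensor.map (Z.d i j).hom (LinearMap.id : M →ₗ[R] M) y = x ∧
      BalTensor.map (LinearMap.id : Z.X i →ₗ[Rᵐᵒᵖ] Z.X i) g y = 0 := by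
  obtain ⟨Q, _, _, h, hgh, hh⟩ : ∃ (Q : Type u) (_ : AddCommGroup Q) (_ : Module R Q)
      (h : P →ₗ[R] Q), Function.Exact g h ∧ Function.Surjective h :=
    ⟨P ⧸ LinearMap.range g, inferInstance, inferInstance, (LinearMap.range g).mkQ,
      LinearMap.exact_map_mkQ_range g, Submodule.mkQ_surjective _⟩
  have hex : ∀ (N : Type u) [AddCommGroup N] [Module R N] (i j k : ℤ), i + 1 = j → j + 1 = k →
      ∀ x : BalTensor.Carrier R (Z.X j) N,
        BalTensor.map (Z.d j k).hom (LinearMap.id : N →ₗ[R] N) x = 0 →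
        ∃ y, BalTensor.map (Z.d i j).hom (LinearMap.id : N →ₗ[R] N) y = x := fun N _ _ =>
    (pureExactRight_iff Z).1 hZ (ModuleCat.of R N)
  have hcomm : ∀ {N N' : Type u} [AddCommGroup N] [Module R N] [AddCommGroup N'] [Module R N']
      (φ : N →ₗ[R] N') (i j : ℤ) (y : BalTensor.Carrier R (Z.X i) N),
      BalTensor.map (LinearMap.id : Z.X j →ₗ[Rᵐᵒᵖ] Z.X j) φ
        (BalTensor.map (Z.d i j).hom LinearMap.id y) =
      BalTensor.map (Z.d i j).hom (LinearMap.id : N' →ₗ[R] N')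
        (BalTensor.map LinearMap.id φ y) := by
    intro N N' _ _ _ _ φ i j y
    rw [BalTensor.map_map, BalTensor.map_map]
    rfl
  have hdd : ∀ {N : Type u} [AddCommGroup N] [Module R N] (i j k : ℤ)
      (y : BalTensor.Carrier R (Z.X i) N),
      BalTensor.map (Z.d j k).hom (LinearMap.id : N →ₗ[R] N)
        (BalTensor.map (Z.d i j).hom LinearMap.id y) = 0 := by
    intro N _ _ i j k y
    rw [BalTensor.map_map]
    have : (Z.d j k).hom ∘ₗ (Z.d i j).hom = 0 :=
      LinearMap.ext fun z => congrArg (fun φ => φ.hom z) (Z.d_comp_d i j k)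
    rw [this]
    induction y using BalTensor.induction with
    | zero => simp
    | tmul k m => simp
    | add x y hx hy => rw [map_add, hx, hy, add_zero]
  obtain ⟨y, rfl⟩ := hex M i j k hij hjk x hx
  obtain ⟨w, hw⟩ := hex P (i - 1) i j (by lia) hij (BalTensor.map LinearMap.id g y) (by
    rw [← hcomm, hgx])
  obtain ⟨v, hv⟩ := hex Q (i - 2) (i - 1) i (by lia) (by lia) (BalTensor.map LinearMap.id h w) (by
    rw [← hcomm, hw]
    exact (BalTensor.exact_map_left g h hgh hh _).2 ⟨y, rfl⟩)
  obtain ⟨v, rfl⟩ := BalTensor.map_surjective LinearMap.id h Function.surjective_id hh v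
  obtain ⟨t, ht⟩ := (BalTensor.exact_map_left g h hgh hh
      (w - BalTensor.map (Z.d (i - 2) (i - 1)).hom LinearMap.id v)).1 (by
    rw [map_sub, hcomm, hv, sub_self])
  refine ⟨y - BalTensor.map (Z.d (i - 1) i).hom LinearMap.id t, ?_, ?_⟩
  · rw [map_sub, hdd, sub_zero]
  · rw [map_sub, hcomm, ht, map_sub, hdd, sub_zero, hw, sub_self]

namespace tensorComplex

variable (Z : CochainComplex (ModuleCat.{u} Rᵐᵒᵖ) ℤ) (C : CochainComplex (ModuleCat.{u} R) ℤ)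

/-- The inclusion of the summand `Zᵖ ⊗ C^q` in degree `n = p + q`. -/
noncomputable def incl (p q n : ℤ) (h : p + q = n) :
    BalTensor.Carrier R (Z.X p) (C.X q) →+ (tensorComplex Z C).X n :=
  (HomologicalComplex.ιMapBifunctor Z C (tensorFunctor R) (ComplexShape.up ℤ) p q n h).hom

/-- The projection onto the summand `Zᵖ ⊗ C^q` in degree `n = p + q`. -/
noncomputable def proj (p q n : ℤ) (h : p + q = n) :
    (tensorComplex Z C).X n →+ BalTensor.Carrier R (Z.X p) (C.X q) :=
  (HomologicalComplex.mapBifunctorDesc (K₁ := Z) (K₂ := C) (F := tensorFunctor R)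
    (c := ComplexShape.up ℤ) (j := n)
    (A := ((tensorFunctor R).obj (Z.X p)).obj (C.X q))
    (fun p' q' h' => if hq : q' = q then
      eqToHom (by
        obtain rfl : p' = p := by
          have : p' + q' = n := h'
          lia
        rw [hq]) else 0)).hom

variable {Z C}

lemma proj_incl_apply (p q p' q' n : ℤ) (h : p + q = n) (h' : p' + q' = n)
    (x : BalTensor.Carrier R (Z.X p') (C.X q')) :
    proj Z C p q n h (incl Z C p' q' n h' x) = if hq : q' = q then
      (show p' = p by lia) ▸ hq ▸ x else 0 := by
  have h1 := HomologicalComplex.ι_mapBifunctorDesc (K₁ := Z) (K₂ := C) (F := tensorFunctor R)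
    (c := ComplexShape.up ℤ) (j := n)
    (A := ((tensorFunctor R).obj (Z.X p)).obj (C.X q))
    (fun p' q' h' => if hq : q' = q then
      eqToHom (by
        obtain rfl : p' = p := by
          have : p' + q' = n := h'
          lia
        rw [hq]) else 0) p' q' h'
  refine (congrArg (fun f => f.hom x) h1).trans ?_
  by_cases hq : q' = q
  · subst hq
    obtain rfl : p' = p := by lia
    simp only [dite_true]
    rw [eqToHom_refl]
    rfl
  · rw [dif_neg hq, dif_neg hq]
    rfl

@[simp]
lemma proj_incl (p q n : ℤ) (h : p + q = n) (x : BalTensor.Carrier R (Z.X p) (C.X q)) :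
    proj Z C p q n h (incl Z C p q n h x) = x := by
  rw [proj_incl_apply]
  simp

lemma proj_incl_of_ne {p q p' q' n : ℤ} (h : p + q = n) (h' : p' + q' = n) (hq : q' ≠ q)
    (x : BalTensor.Carrier R (Z.X p') (C.X q')) :
    proj Z C p q n h (incl Z C p' q' n h' x) = 0 := by
  rw [proj_incl_apply, dif_neg hq]

lemma d_incl (p p' q q' n n' : ℤ) (h : p + q = n) (hp : p + 1 = p') (hq : q + 1 = q')
    (hn : n + 1 = n') (x : BalTensor.Carrier R (Z.X p) (C.X q)) :
    (tensorComplex Z C).d n n' (incl Z C p q n h x) =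
      incl Z C p' q n' (by lia) (BalTensor.map (Z.d p p').hom LinearMap.id x) +
      p.negOnePow • incl Z C p q' n' (by lia) (BalTensor.map LinearMap.id (C.d q q').hom x) := by
  have h1 : HomologicalComplex.ιMapBifunctor Z C (tensorFunctor R) (ComplexShape.up ℤ) p q n h ≫
      (HomologicalComplex.mapBifunctor Z C (tensorFunctor R) (ComplexShape.up ℤ)).d n n' =
      ((tensorFunctor R).map (Z.d p p')).app (C.X q) ≫
        HomologicalComplex.ιMapBifunctor Z C (tensorFunctor R) (ComplexShape.up ℤ) p' q n'
          (by change p' + q = n'; lia) +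
      p.negOnePow • (((tensorFunctor R).obj (Z.X p)).map (C.d q q') ≫
        HomologicalComplex.ιMapBifunctor Z C (tensorFunctor R) (ComplexShape.up ℤ) p q' n'
          (by change p + q' = n'; lia)) := by
    rw [HomologicalComplex.mapBifunctor.d_eq, Preadditive.comp_add,
      HomologicalComplex.mapBifunctor.ι_D₁, HomologicalComplex.mapBifunctor.ι_D₂,
      HomologicalComplex.mapBifunctor.d₁_eq Z C _ _ (show (ComplexShape.up ℤ).Rel p p' from hp) q n'
        (by change p' + q = n'; lia),
      HomologicalComplex.mapBifunctor.d₂_eq Z C _ _ p (show (ComplexShape.up ℤ).Rel q q' from hq) n'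
        (by change p + q' = n'; lia)]
    congr 1
    exact one_smul _ _
  exact congrArg (fun f => f.hom x) h1

lemma induction {n : ℤ} {motive : (tensorComplex Z C).X n → Prop}
    (incl : ∀ p q h x, motive (incl Z C p q n h x)) (neg : ∀ x, motive x → motive (-x))
    (add : ∀ x y, motive x → motive y → motive (x + y)) (x : (tensorComplex Z C).X n) :
    motive x := by
  let H : AddSubgroup ((tensorComplex Z C).X n) :=
    { carrier := {x | motive x}
      zero_mem' := by
        have := incl n 0 (add_zero n) 0
        rwa [map_zero] at this
      add_mem' := add _ _
      neg_mem' := neg _ }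
  have h : AddCommGrpCat.ofHom (QuotientAddGroup.mk' H) = 0 := by
    refine HomologicalComplex.mapBifunctor.hom_ext fun p q h => ?_
    ext x
    exact (QuotientAddGroup.eq_zero_iff _).2 (incl p q h x)
  exact (QuotientAddGroup.eq_zero_iff x).1 (congrArg (fun f => f.hom x) h)

lemma proj_d (p p' q q' n n' : ℤ) (h : p + q' = n) (hp : p + 1 = p') (hq : q + 1 = q')
    (hn : n + 1 = n') (x : (tensorComplex Z C).X n) :
    proj Z C p' q' n' (by lia) ((tensorComplex Z C).d n n' x) =
      BalTensor.map (Z.d p p').hom LinearMap.id (proj Z C p q' n h x) +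
      p'.negOnePow • BalTensor.map LinearMap.id (C.d q q').hom
        (proj Z C p' q n (by lia) x) := by
  induction x using induction with
  | incl a b hab x =>
    rw [d_incl a (a + 1) b (b + 1) n n' hab rfl rfl hn, map_add, Units.smul_def, map_zsmul,
      Units.smul_def]
    by_cases hb : b = q'
    · subst hb
      obtain rfl : a = p := by lia
      subst hp
      rw [proj_incl, proj_incl, proj_incl_of_ne _ _ (by lia), proj_incl_of_ne _ _ (by lia)]
      simp
    · rw [proj_incl_of_ne _ _ hb, proj_incl_of_ne _ _ hb]
      by_cases hb' : b = q
      · subst hb'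
        obtain rfl : a = p' := by lia
        subst hq
        rw [proj_incl, proj_incl]
        simp
      · rw [proj_incl_of_ne _ _ (by lia), proj_incl_of_ne _ _ hb']
        simp
  | neg x hx =>
    simp only [map_neg, hx, smul_neg]
    abel
  | add x y hx hy =>
    simp only [map_add, hx, hy, smul_add]
    abel

lemma exists_finset_proj {n : ℤ} (x : (tensorComplex Z C).X n) :
    ∃ F : Finset ℤ, (∀ p q h, q ∉ F → proj Z C p q n h x = 0) ∧
      ∀ F' : Finset ℤ, F ⊆ F' → x = ∑ q ∈ F', incl Z C (n - q) q n (by lia)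
        (proj Z C (n - q) q n (by lia) x) := by
  induction x using induction with
  | incl p q h x =>
    refine ⟨{q}, fun p' q' h' hq' => proj_incl_of_ne _ _ (by simpa [eq_comm] using hq') x,
      fun F' hF' => ?_⟩
    rw [Finset.sum_eq_single q]
    · have : ∀ r (_ : r = p) (h' : r + q = n), incl Z C p q n h x =
          incl Z C r q n h' (proj Z C r q n h' (incl Z C p q n h x)) := by
        rintro r rfl h'
        rw [proj_incl]
      exact this (n - q) (by lia) _
    · intro b _ hb
      rw [proj_incl_of_ne _ _ hb.symm, map_zero]
    · intro h
      exact absurd (hF' (Finset.mem_singleton_self q)) h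
  | neg x hx =>
    obtain ⟨F, hF, hF'⟩ := hx
    refine ⟨F, fun p q h hq => by rw [map_neg, hF p q h hq, neg_zero], fun F' h => ?_⟩
    conv_lhs => rw [hF' F' h]
    simp
  | add x y hx hy =>
    obtain ⟨F, hF, hF'⟩ := hx
    obtain ⟨G, hG, hG'⟩ := hy
    refine ⟨F ∪ G, fun p q h hq => ?_, fun F' h => ?_⟩
    · rw [Finset.mem_union, not_or] at hq
      rw [map_add, hF p q h hq.1, hG p q h hq.2, add_zero]
    · conv_lhs => rw [hF' F' (Finset.union_subset_left h), hG' F' (Finset.union_subset_right h)]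
      simp [Finset.sum_add_distrib]

lemma ext_proj {n : ℤ} {x y : (tensorComplex Z C).X n}
    (h : ∀ p q h, proj Z C p q n h x = proj Z C p q n h y) : x = y := by
  rw [← sub_eq_zero]
  obtain ⟨F, -, hF⟩ := exists_finset_proj (x - y)
  rw [hF F subset_rfl]
  exact Finset.sum_eq_zero fun q _ => by rw [map_sub, h, sub_self, map_zero]

/-- A cycle of `Z ⊗ C` whose components `x_q` in `Z ⊗ C^q` vanish unless `a ≤ q ≤ a + m` is a
boundary. For `m > 0` one removes the lowest component, which is a cycle of `Z ⊗ C^a`; for `m = 0`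
the cycle lies in the kernel of `Z ⊗ C^a → Z ⊗ C^(a+1)`. -/
lemma exists_of_d_eq_zero (hZ : PureExactRight Z) {n₀ n n₁ : ℤ} (h₀ : n₀ + 1 = n) (h₁ : n + 1 = n₁)
    (m : ℕ) (a : ℤ) (x : (tensorComplex Z C).X n) (hx : (tensorComplex Z C).d n n₁ x = 0)
    (hxa : ∀ p q h, q < a ∨ a + m < q → proj Z C p q n h x = 0) :
    ∃ y : (tensorComplex Z C).X n₀, (tensorComplex Z C).d n₀ n y = x := by
  have hxa' : ∀ {a : ℤ} {x : (tensorComplex Z C).X n}, (tensorComplex Z C).d n n₁ x = 0 →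
      proj Z C (n - a + 1) (a - 1) n (by lia) x = 0 →
      BalTensor.map (Z.d (n - a) (n - a + 1)).hom LinearMap.id
        (proj Z C (n - a) a n (by lia) x) = 0 := by
    intro a x hx hxa
    have := proj_d (n - a) (n - a + 1) (a - 1) a n n₁ (by lia) rfl (by lia) h₁ x
    rw [hx, hxa, map_zero, map_zero, smul_zero, add_zero] at this
    exact this.symm
  induction m generalizing a x with
  | zero =>
    have h2 : BalTensor.map LinearMap.id (C.d a (a + 1)).hom
        (proj Z C (n - a) a n (by lia) x) = 0 := by
      have := proj_d (n - a - 1) (n - a) a (a + 1) n n₁ (by lia) (by lia) rfl h₁ x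
      rw [hx, hxa (n - a - 1) (a + 1) (by lia) (by lia), map_zero, map_zero, zero_add] at this
      rcases Int.units_eq_one_or (n - a).negOnePow with h | h
      · rw [h, one_smul] at this
        exact this.symm
      · rw [h, Units.neg_smul, one_smul] at this
        exact neg_eq_zero.1 this.symm
    obtain ⟨y, hy, hy'⟩ := hZ.exists_of_map_eq_zero (C.d a (a + 1)).hom
      (show n₀ - a + 1 = n - a by lia) rfl _ (hxa' hx (hxa _ _ _ (by lia))) h2
    refine ⟨incl Z C (n₀ - a) a n₀ (by lia) y, ext_proj fun p q h => ?_⟩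
    rw [d_incl (n₀ - a) (n - a) a (a + 1) n₀ n (by lia) (by lia) rfl h₀, hy, hy', map_zero,
      smul_zero, add_zero]
    by_cases hq : a = q
    · subst hq
      obtain rfl : p = n - a := by lia
      rw [proj_incl]
    · rw [proj_incl_of_ne _ _ hq, hxa p q h (by simp; lia)]
  | succ m ih =>
    obtain ⟨y, hy⟩ := (pureExactRight_iff Z).1 hZ (C.X a) (n₀ - a) (n - a) _ (by lia) rfl _
      (hxa' hx (hxa _ _ _ (by lia)))
    obtain ⟨w, hw⟩ := ih (a + 1)
      (x - (tensorComplex Z C).d n₀ n (incl Z C (n₀ - a) a n₀ (by lia) y)) (by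
        rw [map_sub, hx, zero_sub, neg_eq_zero]
        exact ConcreteCategory.congr_hom ((tensorComplex Z C).d_comp_d n₀ n n₁) _)
      (fun p q h hq => by
        rw [d_incl (n₀ - a) (n - a) a (a + 1) n₀ n (by lia) (by lia) rfl h₀, hy, map_sub, map_add,
          Units.smul_def, map_zsmul, proj_incl_of_ne _ _ (show a + 1 ≠ q by lia), smul_zero,
          add_zero]
        by_cases hqa : a = q
        · subst hqa
          obtain rfl : p = n - a := by lia
          rw [proj_incl, sub_self]
        · rw [proj_incl_of_ne _ _ hqa, hxa p q h (by push_cast at hq ⊢; lia), sub_zero])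
    exact ⟨w + incl Z C (n₀ - a) a n₀ (by lia) y, by rw [map_add, hw, sub_add_cancel]⟩

end tensorComplex

theorem PureExactRight.acyclic_tensorComplex {Z : CochainComplex (ModuleCat.{u} Rᵐᵒᵖ) ℤ}
    (hZ : PureExactRight Z) (C : CochainComplex (ModuleCat.{u} R) ℤ) :
    (tensorComplex Z C).Acyclic := by
  rw [acyclic_iff_forall_exists]
  intro n₀ n n₁ h₀ h₁ x hx
  obtain ⟨F, hF, -⟩ := tensorComplex.exists_finset_proj x
  obtain ⟨a, ha⟩ := F.bddBelow
  obtain ⟨b, hb⟩ := F.bddAbove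
  refine tensorComplex.exists_of_d_eq_zero hZ h₀ h₁ (b - a).toNat a x hx fun p q h hq =>
    hF p q h fun hqF => ?_
  have h1 := ha hqF
  have h2 := hb hqF
  lia

theorem theoremA1 (R : Type u) [Ring R] :
    (∀ C : CochainComplex (ModuleCat.{u} R) ℤ, (∀ n : ℤ, Module.Projective R (C.X n)) →
      (∀ Y : CochainComplex (ModuleCat.{u} R) ℤ, PureExact Y →
        (CochainComplex.HomComplex C Y).Acyclic ∧ Subsingleton (Abelian.Ext.{u} C Y 1)) ∧
      (∀ Z : CochainComplex (ModuleCat.{u} Rᵐᵒᵖ) ℤ, PureExactRight Z →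
        (tensorComplex Z C).Acyclic)) ∧
    (∀ Y : CochainComplex (ModuleCat.{u} R) ℤ, Y.Acyclic →
      (∀ n : ℤ, IsFlatModule (Y.X n)) → (∀ n : ℤ, IsFlatModule (Y.cycles n)) →
        PureExact Y) := by
  refine ⟨fun C hC => ⟨fun Y hY => ⟨hY.acyclic_homComplex hC, hY.subsingleton_ext_one hC⟩,
    fun Z hZ => hZ.acyclic_tensorComplex C⟩, fun Y hY _ hZ => ?_⟩
  exact pureExact_of_isFlatModule_cycles Y hY hZ
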